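/- Let $A_0, A_1, A_2, \ldots$ be complex-valued random variables on a common probability space, not necessarily independent and not necessarily identically distributed, and let $F_k(x) = \mathbb{P}(|A_k| \le x)$, $x\in\mathbb{R}$, be the distribution function of $|A_k|$. Assume: (2.1) there are $a>1$ and a decreasing (i.e. nonincreasing) function $f:[a,\infty)\to[0,1]$ such that $$\int_a^\infty \frac{f(x)}{x}\,dx < \infty \quad\text{and}\quad 1-F_k(x)\le f(x) \ \text{ for all } x\in[a,\infty) \text{ and all } k=0,1,2,\ldots;$$ (2.2) there are $0<b<1$ and an increasing (i.e. nondecreasing) function $g:[0,b]\to[0,1]$ such that $$\int_0^b \frac{g(x)}{x}\,dx < \infty \quad\text{and}\quad F_k(x)\le g(x) \ \text{ for all } x\in[0,b] \text{ and all } k=0,1,2,\ldots.$$ Let $P_n(z)=\sum_{k=0}^n A_k z^k$. Then almost surely the following holds: each $P_n$ has degree exactly $n$, and the zero counting measures $$\tau_n = \frac1n\sum_{k=1}^n \delta_{Z_{k,n}}, \qquad n\ge 1,$$ where $Z_{1,n},\ldots,Z_{n,n}$ are the zeros of $P_n$ listed with multiplicity, converge weakly, as $n\to\infty$, to the normalized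 arclength measure $\mu_{\mathbb{T}}$ on the unit circle, $d\mu_{\mathbb{T}}(e^{it}) = dt/(2\pi)$; that is, almost surely $\int \varphi\,d\tau_n \to \frac{1}{2\pi}\int_0^{2\pi}\varphi(e^{it})\,dt$ for every bounded continuous $\varphi:\mathbb{C}\to\mathbb{R}$. -/

import Mathlib

open MeasureTheory Filter Topology
open scoped ENNReal

noncomputable section

/-- The distribution function `F(x) = ℙ(|X| ≤ x)` of the absolute value of a complex random
variable `X`. -/
def absDistribution {Ω : Type*} [MeasurableSpace Ω] (P : Measure Ω) (X : Ω → ℂ) (x : ℝ) : ℝ :=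
  P.real {ω | ‖X ω‖ ≤ x}

/-- Uniform logarithmic tail bound for large values: one decreasing function
`f : [a, ∞) → [0, 1]`, `a > 1`, with `∫_a^∞ f(x)/x dx < ∞` dominates `1 - F_k` on `[a, ∞)`
for every `k = 0, 1, 2, …`. -/
def UniformUpperLogTail {Ω : Type*} [MeasurableSpace Ω] (P : Measure Ω) (A : ℕ → Ω → ℂ) : Prop :=
  ∃ (a : ℝ) (f : ℝ → ℝ), 1 < a ∧ AntitoneOn f (Set.Ici a) ∧
    (∀ x ∈ Set.Ici a, f x ∈ Set.Icc (0 : ℝ) 1) ∧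
    IntegrableOn (fun x => f x / x) (Set.Ici a) ∧
    ∀ k, ∀ x ∈ Set.Ici a, 1 - absDistribution P (A k) x ≤ f x

/-- Uniform logarithmic tail bound for small values: one increasing function
`g : [0, b] → [0, 1]`, `0 < b < 1`, with `∫_0^b g(x)/x dx < ∞` dominates `F_k` on `[0, b]`
for every `k = 0, 1, 2, …`. -/
def UniformLowerLogTail {Ω : Type*} [MeasurableSpace Ω] (P : Measure Ω) (A : ℕ → Ω → ℂ) : Prop :=
  ∃ (b : ℝ) (g : ℝ → ℝ), 0 < b ∧ b < 1 ∧ MonotoneOn g (Set.Icc 0 b) ∧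
    (∀ x ∈ Set.Icc 0 b, g x ∈ Set.Icc (0 : ℝ) 1) ∧
    IntegrableOn (fun x => g x / x) (Set.Ioc 0 b) ∧
    ∀ k, ∀ x ∈ Set.Icc 0 b, absDistribution P (A k) x ≤ g x

/-- The polynomial `∑_{k=0}^n a_k z^k`. -/
def kacPolynomial (a : ℕ → ℂ) (n : ℕ) : Polynomial ℂ :=
  ∑ k ∈ Finset.range (n + 1), Polynomial.C (a k) * Polynomial.X ^ k

/-- The zero counting measure `(1/n) ∑_{k=1}^n δ_{Z_k}` of a polynomial of degree `n`, where
`Z_1, …, Z_n` are its zeros listed with multiplicity. (It is the zero measure if `p` is constant.) -/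
def zeroCountingMeasure (p : Polynomial ℂ) : Measure ℂ :=
  (p.natDegree : ℝ≥0∞)⁻¹ • (p.roots.map Measure.dirac).sum

instance isFiniteMeasure_zeroCountingMeasure (p : Polynomial ℂ) :
    IsFiniteMeasure (zeroCountingMeasure p) := by
  have key : ∀ s : Multiset ℂ, IsFiniteMeasure (s.map Measure.dirac).sum := by
    intro s
    induction s using Multiset.induction_on with
    | empty => simpa using (inferInstance : IsFiniteMeasure (0 : Measure ℂ))
    | cons z s ih =>
      rw [Multiset.map_cons, Multiset.sum_cons]
      infer_instance
  by_cases h : p.natDegree = 0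
  · have h0 : p.roots = 0 := by
      rw [Polynomial.eq_C_of_natDegree_eq_zero h, Polynomial.roots_C]
    unfold zeroCountingMeasure
    rw [h0, Multiset.map_zero, Multiset.sum_zero, smul_zero]
    infer_instance
  · have := key p.roots
    exact Measure.smul_finite _ (ENNReal.inv_ne_top.2 (by exact_mod_cast h))

/-- The normalized arclength measure `dμ(e^{it}) = dt/(2π)` on the unit circle, as a Borel
measure on `ℂ`. -/
def unitCircleMeasure : Measure ℂ :=
  (ENNReal.ofReal (2 * Real.pi))⁻¹ •
    (volume.restrict (Set.Ioc 0 (2 * Real.pi))).map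
      (fun t : ℝ => Complex.exp (t * Complex.I))

instance isProbabilityMeasure_unitCircleMeasure : IsProbabilityMeasure unitCircleMeasure := by
  constructor
  have hm : Measurable (fun t : ℝ => Complex.exp (t * Complex.I)) := by fun_prop
  unfold unitCircleMeasure
  rw [Measure.smul_apply, Measure.map_apply hm MeasurableSet.univ]
  simp only [Set.preimage_univ, Measure.restrict_apply_univ, Real.volume_Ioc, sub_zero, smul_eq_mul]
  exact ENNReal.inv_mul_cancel (by simp [Real.pi_pos]) ENNReal.ofReal_ne_top

/-- `zeroCountingMeasure` as a point of the space of finite Borel measures on `ℂ`, which carries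
the topology of weak convergence. -/
def zeroCountingFiniteMeasure (p : Polynomial ℂ) : FiniteMeasure ℂ :=
  ⟨zeroCountingMeasure p, inferInstance⟩

/-- `unitCircleMeasure` as a finite Borel measure on `ℂ`. -/
def unitCircleFiniteMeasure : FiniteMeasure ℂ :=
  ⟨unitCircleMeasure, inferInstance⟩

end

/-! Everything is deterministic once no `a k` vanishes and `|a_k|^(1/k) → 1`
(`SubexponentialCoeffs`). Almost every outcome is of this kind by the convergent half of
Borel–Cantelli, which needs no independence: after `x = e^t` the integrals become `∫ f(e^t) dt` and
`∫ g(e^(-t)) dt`, and monotonicity turns them into summability of `f(e^(εk))` and `g(e^(-εk))`.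

Radial part: Jensen's formula expresses `∑ |log |z||` over the zeros through the Mahler measure,
`a_n` and `a_0` (`sum_abs_log_norm_roots`), so it is `o(n)`. Hence projecting the zeros radially
onto the circle does not change the limits of averages of bounded continuous functions
(`tendsto_average_sub_radial`).

Angular part: by Newton's identities (`newton_reciprocal_roots`) the sum of `z^(-j)` over the zeros
involves only `a_0, …, a_j` once `n ≥ j`, so its average tends to `0`. The zeros stay away from the
origin, where `z^(-j)` blows up, so the radial part applies to `z^(-j)` and yields Weyl's criterion
for the arguments. Density of trigonometric polynomials concludes (`tendsto_average_angle`). -/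

theorem degree_kacPolynomial {a : ℕ → ℂ} {n : ℕ} (ha : a n ≠ 0) :
    (kacPolynomial a n).degree = n := by
  have hlt : (∑ k ∈ Finset.range n, Polynomial.C (a k) * Polynomial.X ^ k).degree
      < (Polynomial.C (a n) * Polynomial.X ^ n).degree := by
    rw [Polynomial.degree_C_mul_X_pow _ ha]
    refine (Polynomial.degree_lt_iff_coeff_zero _ _).2 fun m hm => ?_
    simp [Polynomial.coeff_X_pow, hm]
  rw [kacPolynomial, Finset.sum_range_succ, Polynomial.degree_add_eq_right_of_degree_lt hlt,
    Polynomial.degree_C_mul_X_pow _ ha]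

theorem coeff_kacPolynomial (a : ℕ → ℂ) (n k : ℕ) :
    (kacPolynomial a n).coeff k = if k ≤ n then a k else 0 := by
  simp [kacPolynomial, Polynomial.coeff_X_pow]

theorem natDegree_kacPolynomial {a : ℕ → ℂ} {n : ℕ} (ha : a n ≠ 0) :
    (kacPolynomial a n).natDegree = n :=
  Polynomial.natDegree_eq_of_degree_eq_some (degree_kacPolynomial ha)

theorem leadingCoeff_kacPolynomial {a : ℕ → ℂ} {n : ℕ} (ha : a n ≠ 0) :
    (kacPolynomial a n).leadingCoeff = a n := by
  rw [Polynomial.leadingCoeff, natDegree_kacPolynomial ha, coeff_kacPolynomial, if_pos le_rfl]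

theorem kacPolynomial_ne_zero {a : ℕ → ℂ} {n : ℕ} (ha : a n ≠ 0) : kacPolynomial a n ≠ 0 := by
  intro h
  have := leadingCoeff_kacPolynomial ha
  rw [h, Polynomial.leadingCoeff_zero] at this
  exact ha this.symm

theorem card_roots_kacPolynomial {a : ℕ → ℂ} {n : ℕ} (ha : a n ≠ 0) :
    (kacPolynomial a n).roots.card = n := by
  rw [← (IsAlgClosed.splits (kacPolynomial a n)).natDegree_eq_card_roots,
    natDegree_kacPolynomial ha]

theorem eval_kacPolynomial (a : ℕ → ℂ) (n : ℕ) (z : ℂ) :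
    (kacPolynomial a n).eval z = ∑ k ∈ Finset.range (n + 1), a k * z ^ k := by
  simp [kacPolynomial, Polynomial.eval_finsetSum]

/-! ### Newton's identities and Jensen's formula for the roots -/

/-- The logarithmic derivative at `0`, as a formal power series, of a polynomial given by its
nonzero roots. -/
theorem powerSeries_derivative_prod_X_sub_C (c : ℂ) (s : Multiset ℂ) (hs : ∀ z ∈ s, z ≠ 0) :
    (↑(Polynomial.derivative
        (Polynomial.C c * (s.map fun z => Polynomial.X - Polynomial.C z).prod)) : PowerSeries ℂ)
      = -(↑(Polynomial.C c * (s.map fun z => Polynomial.X - Polynomial.C z).prod) *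
        PowerSeries.mk fun l => (s.map fun z => (z⁻¹) ^ (l + 1)).sum) := by
  induction s using Multiset.induction_on with
  | empty =>
    have : (PowerSeries.mk fun _ : ℕ => (0 : ℂ)) = 0 := by ext; simp
    simp [this]
  | cons z s ih =>
    have hz : z ≠ 0 := hs z (Multiset.mem_cons_self _ _)
    specialize ih fun w hw => hs w (Multiset.mem_cons_of_mem hw)
    set Q := Polynomial.C c * (s.map fun z => Polynomial.X - Polynomial.C z).prod with hQ
    have hprod : Polynomial.C c *
        ((z ::ₘ s).map fun z => Polynomial.X - Polynomial.C z).prod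
          = (Polynomial.X - Polynomial.C z) * Q := by
      rw [Multiset.map_cons, Multiset.prod_cons, hQ]; ring
    clear_value Q
    have hmk : (PowerSeries.mk fun l => ((z ::ₘ s).map fun z => (z⁻¹) ^ (l + 1)).sum)
        = (PowerSeries.mk fun l => (z⁻¹) ^ (l + 1))
          + PowerSeries.mk fun l => (s.map fun z => (z⁻¹) ^ (l + 1)).sum := by
      ext l; simp
    -- Geometric series of `1/(z - X)`, which exists because `z ≠ 0`.
    have hgeom : ((PowerSeries.X : PowerSeries ℂ) - PowerSeries.C z) *
        (PowerSeries.mk fun l => (z⁻¹) ^ (l + 1)) = -1 := by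
      ext l
      rw [sub_mul]
      cases l with
      | zero => simp [hz]
      | succ l =>
        simp only [map_sub, PowerSeries.coeff_succ_X_mul, PowerSeries.coeff_C_mul,
          PowerSeries.coeff_mk, map_neg, PowerSeries.coeff_one, if_neg (Nat.succ_ne_zero l)]
        rw [pow_succ z⁻¹ (l + 1), mul_left_comm, mul_inv_cancel₀ hz]
        simp
    rw [hprod, hmk, Polynomial.derivative_mul, Polynomial.coe_add, Polynomial.coe_mul,
      Polynomial.coe_mul, Polynomial.coe_mul, ih]
    simp only [Polynomial.derivative_sub, Polynomial.derivative_X, Polynomial.derivative_C,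
      sub_zero, Polynomial.coe_one, Polynomial.coe_sub, Polynomial.coe_X, Polynomial.coe_C]
    linear_combination (Q : PowerSeries ℂ) * hgeom

/-- Newton's identities for the power sums of the reciprocal roots. -/
theorem newton_reciprocal_roots (p : Polynomial ℂ) (hp : ∀ z ∈ p.roots, z ≠ 0) (j : ℕ) :
    p.coeff (j + 1) * (j + 1) = -∑ i ∈ Finset.range (j + 1),
      p.coeff (j - i) * (p.roots.map fun z => (z⁻¹) ^ (i + 1)).sum := by
  have h := powerSeries_derivative_prod_X_sub_C p.leadingCoeff p.roots hp
  rw [← (IsAlgClosed.splits p).eq_prod_roots] at h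
  have h' := congrArg (PowerSeries.coeff j) h
  rw [Polynomial.coeff_coe, Polynomial.coeff_derivative, map_neg, PowerSeries.coeff_mul,
    ← Finset.Nat.sum_antidiagonal_swap, Finset.Nat.sum_antidiagonal_eq_sum_range_succ_mk] at h'
  simpa using h'

/-- Write `|log r| = 2 log⁺ r - log r`. Jensen's formula evaluates the sum of `log⁺`, and the
product of the roots, read off the constant term, evaluates the sum of `log`. -/
theorem sum_abs_log_norm_roots {p : Polynomial ℂ} (h0 : p.coeff 0 ≠ 0) :
    (p.roots.map fun z => |Real.log ‖z‖|).sum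
      = 2 * Real.log p.mahlerMeasure - Real.log ‖p.leadingCoeff‖ - Real.log ‖p.coeff 0‖ := by
  have hp : p ≠ 0 := by rintro rfl; simp at h0
  have hroot : ∀ z ∈ p.roots, z ≠ 0 := by
    rintro z hz rfl
    rw [Polynomial.mem_roots hp, Polynomial.IsRoot.def, ← Polynomial.coeff_zero_eq_eval_zero] at hz
    exact h0 hz
  have hM := p.logMahlerMeasure_eq_log_leadingCoeff_add_sum_log_roots
  rw [Polynomial.logMahlerMeasure_eq_log_MahlerMeasure] at hM
  have hprod : p.coeff 0 = p.leadingCoeff * (p.roots.map fun z => -z).prod := by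
    rw [Polynomial.coeff_zero_eq_eval_zero, (IsAlgClosed.splits p).eval_eq_prod_roots]
    simp
  have hlog : ∀ s : Multiset ℂ, (∀ z ∈ s, z ≠ 0) →
      Real.log ‖(s.map fun z => -z).prod‖ = (s.map fun z => Real.log ‖z‖).sum ∧
        (s.map fun z => -z).prod ≠ 0 := by
    intro s
    induction s using Multiset.induction_on with
    | empty => simp
    | cons z s ih =>
      intro hs
      obtain ⟨h1, h2⟩ := ih fun w hw => hs w (Multiset.mem_cons_of_mem hw)
      have hz := hs z (Multiset.mem_cons_self _ _)
      simp only [Multiset.map_cons, Multiset.prod_cons, Multiset.sum_cons, norm_mul, norm_neg]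
      rw [Real.log_mul (norm_ne_zero_iff.2 hz) (norm_ne_zero_iff.2 h2), h1]
      exact ⟨rfl, mul_ne_zero (neg_ne_zero.2 hz) h2⟩
  obtain ⟨h1, h2⟩ := hlog _ hroot
  have h3 : Real.log ‖p.coeff 0‖
      = Real.log ‖p.leadingCoeff‖ + (p.roots.map fun z => Real.log ‖z‖).sum := by
    rw [hprod, norm_mul, Real.log_mul (by simpa using hp) (norm_ne_zero_iff.2 h2), h1]
  have habs : ∀ s : Multiset ℂ, (s.map fun z => |Real.log ‖z‖|).sum
      = 2 * (s.map fun z => Real.posLog ‖z‖).sum - (s.map fun z => Real.log ‖z‖).sum := by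
    intro s
    induction s using Multiset.induction_on with
    | empty => simp
    | cons z s ih =>
      have h4 : |Real.log ‖z‖| = 2 * Real.posLog ‖z‖ - Real.log ‖z‖ := by
        rw [Real.posLog]
        rcases le_total 0 (Real.log ‖z‖) with h | h
        · rw [abs_of_nonneg h, max_eq_right h]; ring
        · rw [abs_of_nonpos h, max_eq_left h]; ring
      simp only [Multiset.map_cons, Multiset.sum_cons, ih, h4]
      ring
  rw [habs, h3, hM]
  ring

/-! ### Zeros of polynomials with subexponential coefficients -/

/-- The sequence `|a_k|^(1/k)` tends to `1`, and no `a_k` vanishes. -/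
structure SubexponentialCoeffs (a : ℕ → ℂ) : Prop where
  ne_zero : ∀ k, a k ≠ 0
  upper : ∀ ε > 0, ∀ᶠ k : ℕ in atTop, ‖a k‖ ≤ Real.exp (ε * k)
  lower : ∀ ε > 0, ∀ᶠ k : ℕ in atTop, Real.exp (-(ε * k)) ≤ ‖a k‖

namespace SubexponentialCoeffs

variable {a : ℕ → ℂ}

theorem exists_upper (h : SubexponentialCoeffs a) {ε : ℝ} (hε : 0 < ε) :
    ∃ C : ℝ, 1 ≤ C ∧ ∀ k : ℕ, ‖a k‖ ≤ C * Real.exp (ε * k) := by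
  obtain ⟨N, hN⟩ := eventually_atTop.1 (h.upper ε hε)
  refine ⟨1 + ∑ k ∈ Finset.range N, ‖a k‖, ?_, fun k => ?_⟩
  · have : 0 ≤ ∑ k ∈ Finset.range N, ‖a k‖ := by positivity
    linarith
  · have h0 : 0 ≤ ∑ k ∈ Finset.range N, ‖a k‖ := by positivity
    have h1 : 1 ≤ Real.exp (ε * k) := Real.one_le_exp (by positivity)
    by_cases hk : N ≤ k
    · nlinarith [hN k hk, mul_nonneg h0 (zero_le_one.trans h1)]
    · have := Finset.single_le_sum (f := fun k => ‖a k‖) (fun i _ => norm_nonneg _)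
        (Finset.mem_range.2 (not_le.1 hk))
      nlinarith [mul_nonneg h0 (sub_nonneg.2 h1)]

theorem zero_notMem_roots (h : SubexponentialCoeffs a) (n : ℕ) :
    ∀ z ∈ (kacPolynomial a n).roots, z ≠ 0 := by
  rintro z hz rfl
  rw [Polynomial.mem_roots (kacPolynomial_ne_zero (h.ne_zero n)), Polynomial.IsRoot.def,
    ← Polynomial.coeff_zero_eq_eval_zero, coeff_kacPolynomial] at hz
  exact h.ne_zero 0 (by simpa using hz)

theorem exists_roots_lower_bound (h : SubexponentialCoeffs a) :
    ∃ c : ℝ, 0 < c ∧ c ≤ 1 ∧ ∀ n, ∀ z ∈ (kacPolynomial a n).roots, c ≤ ‖z‖ := by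
  obtain ⟨C, hC1, hC⟩ := h.exists_upper (Real.log_pos one_lt_two)
  have hC' : ∀ k : ℕ, ‖a k‖ ≤ C * 2 ^ k := by
    intro k
    have := hC k
    rwa [mul_comm (Real.log 2), Real.exp_nat_mul, Real.exp_log two_pos] at this
  have ha0 : 0 < ‖a 0‖ := norm_pos_iff.2 (h.ne_zero 0)
  -- With `|a_k| ≤ C 2^k`, the condition `|z| < 1/4` makes the ratio `2|z|` at most `1/2`, so the
  -- nonconstant terms add up to at most `4C|z|`; the second bound makes this less than `|a_0|`.
  refine ⟨min (1 / 4) (‖a 0‖ / (4 * C)), by positivity, (min_le_left _ _).trans (by norm_num), ?_⟩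
  intro n z hz
  by_contra! hlt
  obtain ⟨h1, h2⟩ := lt_min_iff.1 hlt
  rw [Polynomial.mem_roots (kacPolynomial_ne_zero (h.ne_zero n)), Polynomial.IsRoot.def,
    eval_kacPolynomial, Finset.sum_range_succ'] at hz
  have h3 : a 0 = -∑ k ∈ Finset.range n, a (k + 1) * z ^ (k + 1) := by
    linear_combination hz
  have hr : 2 * ‖z‖ ≤ 1 / 2 := by linarith
  have h4 : ‖a 0‖ ≤ ∑ k ∈ Finset.range n, C * (2 * ‖z‖) * (2 * ‖z‖) ^ k := by
    rw [h3, norm_neg]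
    refine (norm_sum_le _ _).trans (Finset.sum_le_sum fun k _ => ?_)
    rw [norm_mul, norm_pow]
    calc ‖a (k + 1)‖ * ‖z‖ ^ (k + 1) ≤ C * 2 ^ (k + 1) * ‖z‖ ^ (k + 1) := by
          gcongr; exact hC' _
      _ = _ := by ring
  have h5 : ∑ k ∈ Finset.range n, (2 * ‖z‖) ^ k ≤ 2 := by
    calc ∑ k ∈ Finset.range n, (2 * ‖z‖) ^ k ≤ ∑ k ∈ Finset.range n, (1 / 2 : ℝ) ^ k := by gcongr
      _ ≤ 2 := sum_geometric_two_le n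
  rw [← Finset.mul_sum] at h4
  have h6 : ‖a 0‖ ≤ C * (2 * ‖z‖) * 2 := h4.trans (by gcongr)
  rw [lt_div_iff₀ (by positivity)] at h2
  linarith

/-- For `n > j` the coefficients in Newton's identity no longer depend on `n`, and `a_0 ≠ 0` lets it
be solved for the highest power sum in terms of the lower ones. -/
theorem tendsto_powerSum (h : SubexponentialCoeffs a) (j : ℕ) :
    Tendsto (fun n : ℕ => (n : ℂ)⁻¹ *
      ((kacPolynomial a n).roots.map fun z => (z⁻¹) ^ (j + 1)).sum) atTop (𝓝 0) := by
  induction j using Nat.strong_induction_on with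
  | _ j ih =>
    have key : ∀ᶠ n : ℕ in atTop, (n : ℂ)⁻¹ *
        ((kacPolynomial a n).roots.map fun z => (z⁻¹) ^ (j + 1)).sum
        = (a 0)⁻¹ * (-((n : ℂ)⁻¹ * (a (j + 1) * (j + 1)))
          - ∑ i ∈ Finset.range j, a (j - i) * ((n : ℂ)⁻¹ *
            ((kacPolynomial a n).roots.map fun z => (z⁻¹) ^ (i + 1)).sum)) := by
      filter_upwards [eventually_ge_atTop (j + 1)] with n hn
      have hnw := newton_reciprocal_roots _ (h.zero_notMem_roots n) j
      rw [Finset.sum_range_succ, Nat.sub_self, coeff_kacPolynomial, coeff_kacPolynomial,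
        if_pos hn, if_pos (Nat.zero_le _)] at hnw
      have hs : ∑ i ∈ Finset.range j, a (j - i) * ((n : ℂ)⁻¹ *
            ((kacPolynomial a n).roots.map fun z => (z⁻¹) ^ (i + 1)).sum)
          = (n : ℂ)⁻¹ * ∑ i ∈ Finset.range j, (kacPolynomial a n).coeff (j - i) *
            ((kacPolynomial a n).roots.map fun z => (z⁻¹) ^ (i + 1)).sum := by
        rw [Finset.mul_sum]
        refine Finset.sum_congr rfl fun i _ => ?_
        rw [coeff_kacPolynomial, if_pos (by omega)]
        ring
      rw [hs, eq_inv_mul_iff_mul_eq₀ (h.ne_zero 0)]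
      linear_combination (n : ℂ)⁻¹ * hnw
    refine Tendsto.congr' (EventuallyEq.symm key) ?_
    have hinv : Tendsto (fun n : ℕ => (n : ℂ)⁻¹) atTop (𝓝 0) := tendsto_inv_atTop_nhds_zero_nat
    have hsum : Tendsto (fun n : ℕ => ∑ i ∈ Finset.range j, a (j - i) * ((n : ℂ)⁻¹ *
        ((kacPolynomial a n).roots.map fun z => (z⁻¹) ^ (i + 1)).sum)) atTop
        (𝓝 (∑ i ∈ Finset.range j, a (j - i) * 0)) :=
      tendsto_finsetSum _ fun i hi => (ih i (Finset.mem_range.1 hi)).const_mul _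
    simpa using ((hinv.mul_const (a (j + 1) * (j + 1))).neg.sub hsum).const_mul (a 0)⁻¹

theorem tendsto_abs_log (h : SubexponentialCoeffs a) :
    Tendsto (fun n : ℕ => (n : ℝ)⁻¹ *
      ((kacPolynomial a n).roots.map fun z => |Real.log ‖z‖|).sum) atTop (𝓝 0) := by
  have hnonneg : ∀ n : ℕ, 0 ≤ (n : ℝ)⁻¹ *
      ((kacPolynomial a n).roots.map fun z => |Real.log ‖z‖|).sum := fun n =>
    mul_nonneg (by positivity) (Multiset.sum_nonneg fun x hx => by
      obtain ⟨z, -, rfl⟩ := Multiset.mem_map.1 hx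
      positivity)
  have hupper : ∀ ε > 0, ∀ᶠ n : ℕ in atTop, (n : ℝ)⁻¹ *
      ((kacPolynomial a n).roots.map fun z => |Real.log ‖z‖|).sum ≤ 6 * ε := by
    intro ε hε
    obtain ⟨C, hC1, hC⟩ := h.exists_upper hε
    -- `K` gathers the terms free of `n`; the others total `5εn`, and `K ≤ εn` eventually.
    set K := 2 * Real.log C + 2 * Real.log (1 / ε) + 2 * ε - Real.log ‖a 0‖ with hK
    have hlim : ∀ᶠ n : ℕ in atTop, K ≤ ε * n :=
      (tendsto_natCast_atTop_atTop.const_mul_atTop hε).eventually_ge_atTop K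
    filter_upwards [hlim, h.lower ε hε, eventually_gt_atTop 0] with n h1 h2 h3
    have hn : (0 : ℝ) < n := by exact_mod_cast h3
    rw [inv_mul_le_iff₀ hn, sum_abs_log_norm_roots (by simpa [coeff_kacPolynomial] using h.ne_zero 0),
      leadingCoeff_kacPolynomial (h.ne_zero n), coeff_kacPolynomial, if_pos (Nat.zero_le _)]
    have h4 : -(ε * n) ≤ Real.log ‖a n‖ := by
      rw [Real.le_log_iff_exp_le (norm_pos_iff.2 (h.ne_zero n))]; exact h2
    have h5 : (kacPolynomial a n).mahlerMeasure
        ≤ C * (1 / ε * Real.exp (ε * (n + 1))) * Real.exp (ε * n) := by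
      refine (Polynomial.mahlerMeasure_le_sum_norm_coeff _).trans ?_
      rw [Polynomial.sum_over_range _ (by simp), natDegree_kacPolynomial (h.ne_zero n)]
      calc ∑ k ∈ Finset.range (n + 1), ‖(kacPolynomial a n).coeff k‖
          ≤ ∑ k ∈ Finset.range (n + 1), C * Real.exp (ε * n) := by
            refine Finset.sum_le_sum fun k hk => ?_
            have hk' : k ≤ n := Nat.lt_succ_iff.1 (Finset.mem_range.1 hk)
            rw [coeff_kacPolynomial, if_pos hk']
            refine (hC k).trans ?_
            gcongr
        _ = C * (n + 1) * Real.exp (ε * n) := by simp; ring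
        -- The number of terms is absorbed into the exponential via `x ≤ e^x` at `x = ε(n + 1)`.
        _ ≤ C * (1 / ε * Real.exp (ε * (n + 1))) * Real.exp (ε * n) := by
            gcongr
            rw [one_div, ← div_eq_inv_mul, le_div_iff₀ hε]
            have := Real.add_one_le_exp (ε * (n + 1))
            linarith
    have h6 : Real.log (kacPolynomial a n).mahlerMeasure
        ≤ Real.log C + (Real.log (1 / ε) + ε * (n + 1)) + ε * n := by
      refine (Real.log_le_log (Polynomial.mahlerMeasure_pos_of_ne_zero
        (kacPolynomial_ne_zero (h.ne_zero n))) h5).trans_eq ?_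
      rw [Real.log_mul (by positivity) (by positivity), Real.log_mul (by positivity) (by positivity),
        Real.log_mul (by positivity) (by positivity), Real.log_exp, Real.log_exp]
    linarith
  rw [Metric.tendsto_nhds]
  intro ε hε
  filter_upwards [hupper (ε / 12) (by positivity)] with n hn
  rw [Real.dist_eq, sub_zero, abs_of_nonneg (hnonneg n)]
  linarith

end SubexponentialCoeffs

/-! ### From power sums to equidistribution -/

open scoped BoundedContinuousFunction

theorem integral_multiset_sum_dirac (s : Multiset ℂ) (φ : ℂ →ᵇ ℂ) :
    Integrable φ (s.map Measure.dirac).sum ∧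
      ∫ z, φ z ∂(s.map Measure.dirac).sum = (s.map φ).sum := by
  induction s using Multiset.induction_on with
  | empty => simp
  | cons z s ih =>
    have hz : Integrable φ (Measure.dirac z) := φ.integrable _
    simp only [Multiset.map_cons, Multiset.sum_cons]
    refine ⟨hz.add_measure ih.1, ?_⟩
    rw [integral_add_measure hz ih.1, ih.2, integral_dirac]

theorem integral_zeroCountingMeasure (p : Polynomial ℂ) (φ : ℂ →ᵇ ℂ) :
    ∫ z, φ z ∂zeroCountingMeasure p = (p.natDegree : ℂ)⁻¹ * (p.roots.map φ).sum := by
  rw [zeroCountingMeasure, integral_smul_measure, (integral_multiset_sum_dirac _ φ).2]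
  simp [Complex.real_smul]

theorem integral_unitCircleMeasure (φ : ℂ →ᵇ ℂ) :
    ∫ z, φ z ∂unitCircleMeasure
      = (2 * Real.pi : ℂ)⁻¹ * ∫ t in (0 : ℝ)..2 * Real.pi, φ (Complex.exp (t * Complex.I)) := by
  have hpi := Real.pi_pos
  rw [unitCircleMeasure, integral_smul_measure, integral_map (by fun_prop)
    φ.continuous.aestronglyMeasurable, intervalIntegral.integral_of_le (by positivity)]
  rw [ENNReal.toReal_inv, ENNReal.toReal_ofReal (by positivity)]
  simp [Complex.real_smul]

theorem Multiset.norm_sum_map_sub_le {α : Type*} (s : Multiset α) (u v : α → ℂ) (B : α → ℝ)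
    (h : ∀ x ∈ s, ‖u x - v x‖ ≤ B x) :
    ‖(s.map u).sum - (s.map v).sum‖ ≤ (s.map B).sum := by
  induction s using Multiset.induction_on with
  | empty => simp
  | cons z s ih =>
    simp only [Multiset.map_cons, Multiset.sum_cons]
    rw [add_sub_add_comm]
    exact (norm_add_le _ _).trans (add_le_add (h z (Multiset.mem_cons_self _ _))
      (ih fun x hx => h x (Multiset.mem_cons_of_mem hx)))

instance fact_two_pi_pos : Fact (0 < 2 * Real.pi) := ⟨Real.two_pi_pos⟩

/-- Near the unit circle, a bounded continuous function is close to its value at the radial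
projection; away from it, the difference is absorbed by `|log |z||`. -/
theorem exists_radial_bound (φ : ℂ →ᵇ ℂ) {ε : ℝ} (hε : 0 < ε) :
    ∃ K : ℝ, ∀ z : ℂ, z ≠ 0 →
      ‖φ z - φ (Complex.exp (z.arg * Complex.I))‖ ≤ ε + K * |Real.log ‖z‖| := by
  have hcont : Continuous ↿(fun (s : ℝ) (u : Circle) => φ (Real.exp s * (u : ℂ))) := by
    change Continuous fun p : ℝ × Circle => φ (Real.exp p.1 * (p.2 : ℂ))
    fun_prop
  -- Compactness of the circle makes `φ(e^s u) → φ(u)` as `s → 0` uniform in `u`.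
  have hunif := Continuous.tendstoUniformly _ hcont 0
  rw [Metric.tendstoUniformly_iff] at hunif
  obtain ⟨δ, hδ, hδ'⟩ := Metric.eventually_nhds_iff.1 (hunif ε hε)
  refine ⟨2 * ‖φ‖ / δ, fun z hz => ?_⟩
  have hzn : 0 < ‖z‖ := norm_pos_iff.2 hz
  have hK : 0 ≤ 2 * ‖φ‖ / δ := by positivity
  by_cases hlog : |Real.log ‖z‖| < δ
  · have h := hδ' (y := Real.log ‖z‖) (by simpa [Real.dist_eq] using hlog) (Circle.exp z.arg)
    have hpol : ((‖z‖ : ℝ) : ℂ) * Complex.exp (z.arg * Complex.I) = z :=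
      Complex.norm_mul_exp_arg_mul_I z
    rw [Real.exp_log hzn, Circle.coe_exp, hpol, dist_comm, dist_eq_norm] at h
    simp only [Real.exp_zero, Complex.ofReal_one, one_mul] at h
    nlinarith [mul_nonneg hK (abs_nonneg (Real.log ‖z‖))]
  · have h1 : ‖φ z - φ (Complex.exp (z.arg * Complex.I))‖ ≤ 2 * ‖φ‖ := by
      rw [← dist_eq_norm]; exact φ.dist_le_two_norm _ _
    have h2 : 2 * ‖φ‖ ≤ 2 * ‖φ‖ / δ * |Real.log ‖z‖| := by
      rw [div_mul_eq_mul_div, le_div_iff₀ hδ]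
      exact mul_le_mul_of_nonneg_left (not_lt.1 hlog) (by positivity)
    linarith

section Equidistribution

variable {s : ℕ → Multiset ℂ}

theorem tendsto_average_sub_radial (hcard : ∀ n, (s n).card = n) (h0 : ∀ n, ∀ z ∈ s n, z ≠ 0)
    (hlog : Tendsto (fun n : ℕ => (n : ℝ)⁻¹ * ((s n).map fun z => |Real.log ‖z‖|).sum) atTop (𝓝 0))
    (φ : ℂ →ᵇ ℂ) :
    Tendsto (fun n : ℕ => (n : ℂ)⁻¹ * ((s n).map φ).sum
      - (n : ℂ)⁻¹ * ((s n).map fun z => φ (Complex.exp (z.arg * Complex.I))).sum)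
      atTop (𝓝 0) := by
  rw [Metric.tendsto_nhds]
  intro ε hε
  obtain ⟨K, hK⟩ := exists_radial_bound φ (half_pos hε)
  have hlim : Tendsto (fun n : ℕ => K * ((n : ℝ)⁻¹ *
      ((s n).map fun z => |Real.log ‖z‖|).sum)) atTop (𝓝 0) := by
    simpa using hlog.const_mul K
  filter_upwards [hlim.eventually_lt_const (half_pos hε), eventually_gt_atTop 0] with n hn hpos
  have hn' : (0 : ℝ) < n := by exact_mod_cast hpos
  rw [dist_zero_right, ← mul_sub, norm_mul, norm_inv, Complex.norm_natCast]
  have h1 := (s n).norm_sum_map_sub_le φ (fun z => φ (Complex.exp (z.arg * Complex.I)))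
    (fun z => ε / 2 + K * |Real.log ‖z‖|) fun z hz => hK z (h0 n z hz)
  rw [Multiset.sum_map_add, Multiset.sum_map_mul_left, Multiset.map_const', Multiset.sum_replicate,
    hcard, nsmul_eq_mul] at h1
  calc _ ≤ (n : ℝ)⁻¹ * (n * (ε / 2) + K * ((s n).map fun z => |Real.log ‖z‖|).sum) := by gcongr
    _ = ε / 2 + K * ((n : ℝ)⁻¹ * ((s n).map fun z => |Real.log ‖z‖|).sum) := by field_simp
    _ < ε := by linarith

/-- A bounded continuous function on `ℂ` which agrees with `z ↦ z⁻ʲ` on `c ≤ |z|`. -/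
noncomputable def truncatedInvPow (c : ℝ) (hc : 0 < c) (j : ℕ) : ℂ →ᵇ ℂ :=
  BoundedContinuousFunction.ofNormedAddCommGroup
    -- This is `z⁻¹ = conj z / |z|²` with the modulus in the denominator cut off below at `c`.
    (fun z => (star z / ((max ‖z‖ c : ℝ) : ℂ) ^ 2) ^ j)
    (by
      have : ∀ z : ℂ, ((max ‖z‖ c : ℝ) : ℂ) ^ 2 ≠ 0 := fun z =>
        pow_ne_zero _ (Complex.ofReal_ne_zero.2 (lt_max_of_lt_right hc).ne')
      fun_prop (disch := assumption))
    ((c⁻¹) ^ j)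
    (fun z => by
      have hm : 0 < max ‖z‖ c := lt_max_of_lt_right hc
      rw [norm_pow, norm_div, norm_pow, Complex.norm_real, Real.norm_of_nonneg hm.le, norm_star]
      refine pow_le_pow_left₀ (by positivity) ?_ _
      rw [div_le_iff₀ (by positivity)]
      have h1 : ‖z‖ ≤ max ‖z‖ c := le_max_left _ _
      have h2 : 1 ≤ c⁻¹ * max ‖z‖ c := by
        rw [← div_eq_inv_mul, one_le_div hc]; exact le_max_right _ _
      nlinarith [norm_nonneg z])

theorem truncatedInvPow_apply {c : ℝ} (hc : 0 < c) (j : ℕ) {z : ℂ} (hz : c ≤ ‖z‖) :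
    truncatedInvPow c hc j z = (z⁻¹) ^ j := by
  change (star z / ((max ‖z‖ c : ℝ) : ℂ) ^ 2) ^ j = _
  rw [max_eq_left hz, Complex.inv_def, Complex.normSq_eq_norm_sq, div_eq_mul_inv]
  simp

theorem tendsto_average_exp_neg (hcard : ∀ n, (s n).card = n)
    {c : ℝ} (hc : 0 < c) (hc1 : c ≤ 1) (hs : ∀ n, ∀ z ∈ s n, c ≤ ‖z‖)
    (hlog : Tendsto (fun n : ℕ => (n : ℝ)⁻¹ * ((s n).map fun z => |Real.log ‖z‖|).sum) atTop (𝓝 0))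
    {j : ℕ} (hpow : Tendsto (fun n : ℕ => (n : ℂ)⁻¹ * ((s n).map fun z => (z⁻¹) ^ j).sum)
      atTop (𝓝 0)) :
    Tendsto (fun n : ℕ => (n : ℂ)⁻¹ *
      ((s n).map fun z => Complex.exp (-(j * z.arg * Complex.I))).sum) atTop (𝓝 0) := by
  have h0 : ∀ n, ∀ z ∈ s n, z ≠ 0 := fun n z hz => norm_pos_iff.1 (hc.trans_le (hs n z hz))
  have h := hpow.sub (tendsto_average_sub_radial hcard h0 hlog (truncatedInvPow c hc j))
  rw [sub_zero] at h
  refine h.congr fun n => ?_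
  have h1 : ((s n).map (truncatedInvPow c hc j)) = (s n).map fun z => (z⁻¹) ^ j :=
    Multiset.map_congr rfl fun z hz => truncatedInvPow_apply hc j (hs n z hz)
  have h2 : ((s n).map fun z => truncatedInvPow c hc j (Complex.exp (z.arg * Complex.I)))
      = (s n).map fun z => Complex.exp (-(j * z.arg * Complex.I)) := by
    refine Multiset.map_congr rfl fun z _ => ?_
    rw [truncatedInvPow_apply hc j (by rw [Complex.norm_exp_ofReal_mul_I]; exact hc1),
      ← Complex.exp_neg, ← Complex.exp_nat_mul]
    congr 1; ring
  rw [h1, h2, sub_sub_cancel]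

/-- Negative frequencies are the hypothesis, positive ones follow by conjugation, and frequency `0`
only counts points. -/
theorem tendsto_average_fourier (hcard : ∀ n, (s n).card = n)
    (h : ∀ j : ℕ, Tendsto (fun n : ℕ => (n : ℂ)⁻¹ *
      ((s n).map fun z => Complex.exp (-((j + 1 : ℕ) * z.arg * Complex.I))).sum) atTop (𝓝 0))
    (m : ℤ) :
    Tendsto (fun n : ℕ => (n : ℂ)⁻¹ *
      ((s n).map fun z => fourier m (z.arg : AddCircle (2 * Real.pi))).sum) atTop
      (𝓝 ((2 * Real.pi : ℂ)⁻¹ * ∫ t in (0 : ℝ)..2 * Real.pi,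
        fourier m (t : AddCircle (2 * Real.pi)))) := by
  have hpi : (Real.pi : ℂ) ≠ 0 := Complex.ofReal_ne_zero.2 Real.pi_ne_zero
  have hf : ∀ t : ℝ, fourier m (t : AddCircle (2 * Real.pi)) = Complex.exp (m * Complex.I * t) := by
    intro t
    rw [fourier_coe_apply]
    congr 1
    push_cast
    field_simp
  simp only [hf]
  by_cases hm : m = 0
  · subst hm
    have : (2 * Real.pi : ℂ)⁻¹ * (2 * Real.pi) = 1 := inv_mul_cancel₀ (by simp)
    simp only [Int.cast_zero, zero_mul, Complex.exp_zero, Multiset.map_const', hcard,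
      Multiset.sum_replicate, intervalIntegral.integral_const, sub_zero, Complex.real_smul,
      mul_one, Complex.ofReal_mul, Complex.ofReal_ofNat, this, nsmul_eq_mul]
    refine tendsto_const_nhds.congr' ?_
    filter_upwards [eventually_gt_atTop 0] with n hn
    rw [inv_mul_cancel₀ (by exact_mod_cast hn.ne')]
  · have hint : ∫ t in (0 : ℝ)..2 * Real.pi, Complex.exp (m * Complex.I * t) = 0 := by
      rw [integral_exp_mul_complex (by simp [hm])]
      have : (m : ℂ) * Complex.I * ((2 * Real.pi : ℝ) : ℂ) = m * (2 * Real.pi * Complex.I) := by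
        push_cast; ring
      rw [this, Complex.exp_int_mul_two_pi_mul_I]
      simp
    rw [hint, mul_zero]
    rcases lt_or_gt_of_ne hm with hneg | hpos
    · obtain ⟨j, hj⟩ := Int.eq_succ_of_zero_lt (neg_pos.2 hneg)
      have hmj : (m : ℂ) = -((j + 1 : ℕ) : ℂ) := by
        rw [← neg_eq_iff_eq_neg]; exact_mod_cast hj
      refine (h j).congr fun n => ?_
      congr 3
      funext z
      rw [hmj]
      congr 1; ring
    · obtain ⟨j, hj⟩ := Int.eq_succ_of_zero_lt hpos
      have hmj : (m : ℂ) = ((j + 1 : ℕ) : ℂ) := by exact_mod_cast hj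
      have hconj := (Complex.continuous_conj.tendsto _).comp (h j)
      rw [map_zero] at hconj
      refine hconj.congr fun n => ?_
      simp only [Function.comp_apply, map_mul, map_inv₀, map_natCast, map_multiset_sum,
        Multiset.map_map, ← Complex.exp_conj, map_neg, Complex.conj_I, Complex.conj_ofReal]
      congr 3
      funext z
      rw [hmj]
      congr 1; ring

theorem tendsto_average_angle (hcard : ∀ n, (s n).card = n)
    (h : ∀ m : ℤ, Tendsto (fun n : ℕ => (n : ℂ)⁻¹ *
      ((s n).map fun z => fourier m (z.arg : AddCircle (2 * Real.pi))).sum) atTop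
      (𝓝 ((2 * Real.pi : ℂ)⁻¹ * ∫ t in (0 : ℝ)..2 * Real.pi,
        fourier m (t : AddCircle (2 * Real.pi)))))
    (f : C(AddCircle (2 * Real.pi), ℂ)) :
    Tendsto (fun n : ℕ => (n : ℂ)⁻¹ *
      ((s n).map fun z => f (z.arg : AddCircle (2 * Real.pi))).sum) atTop
      (𝓝 ((2 * Real.pi : ℂ)⁻¹ * ∫ t in (0 : ℝ)..2 * Real.pi,
        f (t : AddCircle (2 * Real.pi)))) := by
  have hii : ∀ f : C(AddCircle (2 * Real.pi), ℂ), IntervalIntegrable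
      (fun t : ℝ => f (t : AddCircle (2 * Real.pi))) volume 0 (2 * Real.pi) := fun f =>
    (f.continuous.comp (AddCircle.continuous_mk' _)).intervalIntegrable _ _
  set F : ℕ → C(AddCircle (2 * Real.pi), ℂ) → ℂ := fun n f => (n : ℂ)⁻¹ *
      ((s n).map fun z => f (z.arg : AddCircle (2 * Real.pi))).sum with hF
  set L : C(AddCircle (2 * Real.pi), ℂ) → ℂ := fun f => (2 * Real.pi : ℂ)⁻¹ *
      ∫ t in (0 : ℝ)..2 * Real.pi, f (t : AddCircle (2 * Real.pi)) with hL
  have hFlip : ∀ n, LipschitzWith 1 (F n) := by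
    intro n
    refine LipschitzWith.of_dist_le_mul fun f g => ?_
    simp only [hF]
    rw [NNReal.coe_one, one_mul, dist_eq_norm, ← mul_sub, norm_mul, norm_inv, Complex.norm_natCast]
    have h1 := (s n).norm_sum_map_sub_le (fun z => f (z.arg : AddCircle (2 * Real.pi)))
      (fun z => g (z.arg : AddCircle (2 * Real.pi))) (fun _ => dist f g) fun z _ => by
        rw [← dist_eq_norm]; exact ContinuousMap.dist_apply_le_dist _
    rw [Multiset.map_const', Multiset.sum_replicate, hcard, nsmul_eq_mul] at h1
    -- At `n = 0` the average is `0` because `0⁻¹ = 0`.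
    rcases Nat.eq_zero_or_pos n with rfl | hn
    · simp
    · rw [inv_mul_le_iff₀ (by exact_mod_cast hn)]
      exact h1
  have hLlip : LipschitzWith 1 L := by
    refine LipschitzWith.of_dist_le_mul fun f g => ?_
    simp only [hL]
    rw [NNReal.coe_one, one_mul, dist_eq_norm, ← mul_sub,
      ← intervalIntegral.integral_sub (hii f) (hii g), norm_mul]
    have h1 : ‖∫ t in (0 : ℝ)..2 * Real.pi, (f (t : AddCircle (2 * Real.pi))
        - g (t : AddCircle (2 * Real.pi)))‖ ≤ dist f g * |2 * Real.pi - 0| :=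
      intervalIntegral.norm_integral_le_of_norm_le_const fun t _ => by
        rw [← dist_eq_norm]; exact ContinuousMap.dist_apply_le_dist _
    have hpi := Real.pi_pos
    rw [sub_zero, abs_of_pos (by positivity)] at h1
    have h2 : ‖(2 * Real.pi : ℂ)⁻¹‖ = (2 * Real.pi)⁻¹ := by
      rw [norm_inv, norm_mul, Complex.norm_real, Real.norm_of_nonneg hpi.le]; simp
    rw [h2, inv_mul_le_iff₀ (by positivity)]
    linarith
  -- The averages are uniformly 1-Lipschitz in `f`, so convergence passes to uniform limits of test
  -- functions.
  have hclosed : IsClosed {f | Tendsto (F · f) atTop (𝓝 (L f))} :=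
    (LipschitzWith.uniformEquicontinuous F 1 hFlip).equicontinuous.isClosed_setOfPred_tendsto
      hLlip.continuous
  have hspan : ∀ f ∈ Submodule.span ℂ (Set.range (@fourier (2 * Real.pi))),
      Tendsto (F · f) atTop (𝓝 (L f)) := by
    intro f hf
    induction hf using Submodule.span_induction with
    | mem f hf =>
      obtain ⟨m, rfl⟩ := hf
      exact h m
    | zero => simp [hF, hL]
    | add f g _ _ hf hg =>
      have hLadd : L (f + g) = L f + L g := by
        simp only [hL, ContinuousMap.add_apply]
        rw [intervalIntegral.integral_add (hii f) (hii g), mul_add]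
      rw [hLadd]
      refine (hf.add hg).congr fun n => ?_
      simp only [hF, ContinuousMap.add_apply, Multiset.sum_map_add, mul_add]
    | smul c f _ hf =>
      have hLsmul : L (c • f) = c * L f := by
        simp only [hL, ContinuousMap.smul_apply, smul_eq_mul]
        rw [intervalIntegral.integral_const_mul]
        ring
      rw [hLsmul]
      refine (hf.const_mul c).congr fun n => ?_
      simp only [hF, ContinuousMap.smul_apply, smul_eq_mul, Multiset.sum_map_mul_left]
      ring
  have hmem : f ∈ (Submodule.span ℂ (Set.range (@fourier (2 * Real.pi)))).topologicalClosure := by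
    rw [span_fourier_closure_eq_top]; trivial
  exact closure_minimal hspan hclosed hmem

theorem tendsto_average_of_powerSums (hcard : ∀ n, (s n).card = n)
    {c : ℝ} (hc : 0 < c) (hc1 : c ≤ 1) (hs : ∀ n, ∀ z ∈ s n, c ≤ ‖z‖)
    (hlog : Tendsto (fun n : ℕ => (n : ℝ)⁻¹ * ((s n).map fun z => |Real.log ‖z‖|).sum) atTop (𝓝 0))
    (hpow : ∀ j : ℕ, Tendsto (fun n : ℕ => (n : ℂ)⁻¹ * ((s n).map fun z => (z⁻¹) ^ (j + 1)).sum)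
      atTop (𝓝 0)) (φ : ℂ →ᵇ ℂ) :
    Tendsto (fun n : ℕ => (n : ℂ)⁻¹ * ((s n).map φ).sum) atTop
      (𝓝 ((2 * Real.pi : ℂ)⁻¹ * ∫ t in (0 : ℝ)..2 * Real.pi, φ (Complex.exp (t * Complex.I)))) := by
  have h0 : ∀ n, ∀ z ∈ s n, z ≠ 0 := fun n z hz => norm_pos_iff.1 (hc.trans_le (hs n z hz))
  let f : C(AddCircle (2 * Real.pi), ℂ) :=
    ⟨fun x => φ (AddCircle.toCircle x), φ.continuous.comp
      (continuous_subtype_val.comp AddCircle.continuous_toCircle)⟩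
  have hf : ∀ t : ℝ, f (t : AddCircle (2 * Real.pi)) = φ (Complex.exp (t * Complex.I)) := by
    intro t
    change φ (AddCircle.toCircle (t : AddCircle (2 * Real.pi))) = _
    rw [AddCircle.toCircle_apply_mk, Circle.coe_exp]
    congr 3
    rw [div_self Real.two_pi_pos.ne', one_mul]
  have h1 := tendsto_average_angle hcard (tendsto_average_fourier hcard fun j =>
    tendsto_average_exp_neg hcard hc hc1 hs hlog (hpow j)) f
  simp only [hf] at h1
  simpa using (tendsto_average_sub_radial hcard h0 hlog φ).add h1

end Equidistribution

theorem SubexponentialCoeffs.tendsto_zeroCountingFiniteMeasure {a : ℕ → ℂ}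
    (h : SubexponentialCoeffs a) :
    Tendsto (fun n => zeroCountingFiniteMeasure (kacPolynomial a n)) atTop
      (𝓝 unitCircleFiniteMeasure) := by
  rw [FiniteMeasure.tendsto_iff_forall_integral_rclike_tendsto ℂ]
  intro φ
  obtain ⟨c, hc, hc1, hroots⟩ := h.exists_roots_lower_bound
  have key := tendsto_average_of_powerSums (fun n => card_roots_kacPolynomial (h.ne_zero n))
    hc hc1 hroots h.tendsto_abs_log h.tendsto_powerSum φ
  rw [← integral_unitCircleMeasure] at key
  refine key.congr fun n => ?_
  change _ = ∫ z, φ z ∂zeroCountingMeasure (kacPolynomial a n)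
  rw [integral_zeroCountingMeasure, natDegree_kacPolynomial (h.ne_zero n)]

/-! ### Logarithmic integral test -/

/-- Lower bounds for `h` on disjoint intervals of constant logarithmic length are summable as soon
as `h(x)/x` is integrable. -/
theorem summable_of_integrableOn_div {h : ℝ → ℝ} {S : Set ℝ}
    (hint : IntegrableOn (fun x => h x / x) S) {ε : ℝ} (hε : 0 < ε) {u v c : ℕ → ℝ}
    (hu : ∀ k, 0 < u k) (huv : ∀ k, v k = u k * Real.exp ε)
    (hdisj : Pairwise (Function.onFun Disjoint fun k => Set.Ioc (u k) (v k)))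
    (hsub : ∀ k, Set.Ioc (u k) (v k) ⊆ S) (hc0 : ∀ k, 0 ≤ c k)
    (hc : ∀ k, ∀ x ∈ Set.Ioc (u k) (v k), c k ≤ h x) : Summable c := by
  have hle : ∀ k, u k ≤ v k := fun k => by
    rw [huv]
    exact le_mul_of_one_le_right (hu k).le (Real.one_le_exp hε.le)
  have hs := (hasSum_integral_iUnion (fun k => measurableSet_Ioc) hdisj
    (hint.mono_set (Set.iUnion_subset hsub))).summable
  -- Each interval has mass `ε` for `dx/x`.
  have hbound : ∀ k, c k * ε ≤ ∫ x in Set.Ioc (u k) (v k), h x / x := by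
    intro k
    have hvk : 0 < v k := (hu k).trans_le (hle k)
    have hlog : ∫ x in u k..v k, x⁻¹ = ε := by
      rw [integral_inv_of_pos (hu k) hvk, huv, mul_div_cancel_left₀ _ (hu k).ne', Real.log_exp]
    have hinv : IntervalIntegrable (fun x : ℝ => x⁻¹) volume (u k) (v k) :=
      intervalIntegral.intervalIntegrable_inv (fun x hx => by
        rw [Set.uIcc_of_le (hle k)] at hx
        exact ((hu k).trans_le hx.1).ne') continuousOn_id
    have hcε : c k * ε = ∫ x in Set.Ioc (u k) (v k), c k * x⁻¹ := by
      rw [integral_const_mul, ← intervalIntegral.integral_of_le (hle k), hlog]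
    rw [hcε]
    refine setIntegral_mono_on (((intervalIntegrable_iff_integrableOn_Ioc_of_le
      (hle k)).1 hinv).const_mul _) (hint.mono_set (hsub k)) measurableSet_Ioc fun x hx => ?_
    rw [div_eq_mul_inv]
    exact mul_le_mul_of_nonneg_right (hc k x hx) (inv_nonneg.2 ((hu k).trans hx.1).le)
  have hcs : Summable fun k => c k * ε :=
    Summable.of_nonneg_of_le (fun k => mul_nonneg (hc0 k) hε.le) hbound hs
  simpa [hε.ne'] using hcs.mul_right ε⁻¹

/-- A decreasing function is smallest at the right endpoint of an interval. The interval to its left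
must also lie in `[a, ∞)`, hence the shift `N + 1` instead of `N`. -/
theorem summable_upper_tail {a : ℝ} {f : ℝ → ℝ} (hf : AntitoneOn f (Set.Ici a))
    (hf01 : ∀ x ∈ Set.Ici a, f x ∈ Set.Icc (0 : ℝ) 1)
    (hint : IntegrableOn (fun x => f x / x) (Set.Ici a)) {ε : ℝ} (hε : 0 < ε) {N : ℕ}
    (hN : a ≤ Real.exp (ε * N)) :
    Summable fun k : ℕ => f (Real.exp (ε * (k + (N + 1) : ℕ))) := by
  have hmono : Monotone fun k : ℕ => Real.exp (ε * (k + N : ℕ)) := fun i j hij => by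
    simp only
    gcongr
  have hge : ∀ k : ℕ, a ≤ Real.exp (ε * (k + N : ℕ)) := fun k => hN.trans (by gcongr; omega)
  refine summable_of_integrableOn_div hint hε (u := fun k : ℕ => Real.exp (ε * (k + N : ℕ)))
    (v := fun k : ℕ => Real.exp (ε * (k + 1 + N : ℕ))) (fun k => Real.exp_pos _) ?_
    hmono.pairwise_disjoint_on_Ioc_succ ?_ ?_ ?_
  · intro k
    rw [← Real.exp_add]
    push_cast
    ring_nf
  · exact fun k x hx => (hge k).trans hx.1.le
  · intro k
    rw [show k + (N + 1) = k + 1 + N by ring]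
    exact (hf01 _ (hge (k + 1))).1
  · intro k x hx
    rw [show k + (N + 1) = k + 1 + N by ring]
    exact hf ((hge k).trans hx.1.le) (hge (k + 1)) hx.2

theorem summable_lower_tail {b : ℝ} {g : ℝ → ℝ} (hg : MonotoneOn g (Set.Icc 0 b))
    (hg01 : ∀ x ∈ Set.Icc 0 b, g x ∈ Set.Icc (0 : ℝ) 1)
    (hint : IntegrableOn (fun x => g x / x) (Set.Ioc 0 b)) {ε : ℝ} (hε : 0 < ε) {N : ℕ}
    (hN : Real.exp (-(ε * N)) ≤ b) :
    Summable fun k : ℕ => g (Real.exp (-(ε * (k + (N + 1) : ℕ)))) := by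
  have hanti : Antitone fun k : ℕ => Real.exp (-(ε * (k + N : ℕ))) := fun i j hij => by
    simp only
    gcongr
  have hle : ∀ k : ℕ, Real.exp (-(ε * (k + N : ℕ))) ≤ b := fun k =>
    le_trans (by gcongr; omega) hN
  refine summable_of_integrableOn_div hint hε
    (u := fun k : ℕ => Real.exp (-(ε * (k + 1 + N : ℕ))))
    (v := fun k : ℕ => Real.exp (-(ε * (k + N : ℕ)))) (fun k => Real.exp_pos _) ?_
    hanti.pairwise_disjoint_on_Ioc_succ ?_ ?_ ?_
  · intro k
    rw [← Real.exp_add]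
    push_cast
    ring_nf
  · exact fun k x hx => ⟨(Real.exp_pos _).trans hx.1, hx.2.trans (hle k)⟩
  · intro k
    rw [show k + (N + 1) = k + 1 + N by ring]
    exact (hg01 _ ⟨(Real.exp_pos _).le, hle (k + 1)⟩).1
  · intro k x hx
    rw [show k + (N + 1) = k + 1 + N by ring]
    exact hg ⟨(Real.exp_pos _).le, hle (k + 1)⟩
      ⟨(Real.exp_pos _).le.trans hx.1.le, hx.2.trans (hle k)⟩ hx.1.le

/-! ### Almost sure growth of the coefficients -/

section Probability

variable {Ω : Type*} [MeasurableSpace Ω] {P : Measure Ω} [IsProbabilityMeasure P]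

theorem ae_eventually_notMem_of_summable_shift {s : ℕ → Set Ω} {c : ℕ → ℝ} {N : ℕ}
    (hc : Summable c) (hs : ∀ k, P.real (s (k + N)) ≤ c k) :
    ∀ᵐ ω ∂P, ∀ᶠ k in atTop, ω ∉ s k := by
  have hsum : Summable fun k => P.real (s k) :=
    (summable_nat_add_iff N).1 (Summable.of_nonneg_of_le (fun _ => measureReal_nonneg) hs hc)
  refine ae_eventually_notMem ?_
  rw [tsum_congr fun k => (ofReal_measureReal (μ := P) (s := s k)).symm]
  exact hsum.tsum_ofReal_ne_top

variable {A : ℕ → Ω → ℂ}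

theorem exists_nat_le_exp_mul (x : ℝ) {ε : ℝ} (hε : 0 < ε) : ∃ N : ℕ, x ≤ Real.exp (ε * N) :=
  ((Real.tendsto_exp_atTop.comp
    (tendsto_natCast_atTop_atTop.const_mul_atTop hε)).eventually_ge_atTop x).exists

theorem exists_nat_exp_neg_mul_le {b ε : ℝ} (hb : 0 < b) (hε : 0 < ε) :
    ∃ N : ℕ, Real.exp (-(ε * N)) ≤ b := by
  obtain ⟨N, hN⟩ := exists_nat_le_exp_mul b⁻¹ hε
  exact ⟨N, by rw [Real.exp_neg]; exact inv_le_of_inv_le₀ hb hN⟩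

theorem UniformUpperLogTail.ae_eventually_le (hA : ∀ k, Measurable (A k))
    (h : UniformUpperLogTail P A) {ε : ℝ} (hε : 0 < ε) :
    ∀ᵐ ω ∂P, ∀ᶠ k : ℕ in atTop, ‖A k ω‖ ≤ Real.exp (ε * k) := by
  obtain ⟨a, f, -, hf, hf01, hint, hle⟩ := h
  obtain ⟨N, hN⟩ := exists_nat_le_exp_mul a hε
  have hae := ae_eventually_notMem_of_summable_shift (P := P)
    (s := fun k => {ω | ‖A k ω‖ ≤ Real.exp (ε * k)}ᶜ)
    (summable_upper_tail hf hf01 hint hε hN) fun k => by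
      rw [probReal_compl_eq_one_sub (measurableSet_le (hA _).norm measurable_const)]
      exact hle (k + (N + 1)) _ (hN.trans (by gcongr; omega))
  filter_upwards [hae] with ω hω
  filter_upwards [hω] with k hk
  exact not_not.1 hk

theorem UniformLowerLogTail.ae_eventually_ge (h : UniformLowerLogTail P A) {ε : ℝ} (hε : 0 < ε) :
    ∀ᵐ ω ∂P, ∀ᶠ k : ℕ in atTop, Real.exp (-(ε * k)) ≤ ‖A k ω‖ := by
  obtain ⟨b, g, hb, -, hg, hg01, hint, hle⟩ := h
  obtain ⟨N, hN⟩ := exists_nat_exp_neg_mul_le hb hε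
  have hae := ae_eventually_notMem_of_summable_shift (P := P)
    (s := fun k => {ω | ‖A k ω‖ ≤ Real.exp (-(ε * k))})
    (summable_lower_tail hg hg01 hint hε hN) fun k =>
      hle (k + (N + 1)) _ ⟨(Real.exp_pos _).le, le_trans (by gcongr; omega) hN⟩
  filter_upwards [hae] with ω hω
  filter_upwards [hω] with k hk
  exact (not_le.1 hk).le

/-- Monotonicity bounds `g 0` by the terms of a summable series, which tend to `0`; so no `A k` has
an atom at the origin. -/
theorem UniformLowerLogTail.ae_ne_zero (h : UniformLowerLogTail P A) :
    ∀ᵐ ω ∂P, ∀ k, A k ω ≠ 0 := by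
  obtain ⟨b, g, hb, -, hg, hg01, hint, hle⟩ := h
  obtain ⟨N, hN⟩ := exists_nat_exp_neg_mul_le hb one_pos
  have hlim := (summable_lower_tail hg hg01 hint one_pos hN).tendsto_atTop_zero
  have h0 : (0 : ℝ) ∈ Set.Icc 0 b := ⟨le_rfl, hb.le⟩
  have hg0 : g 0 ≤ 0 := ge_of_tendsto' hlim fun k =>
    hg h0 ⟨(Real.exp_pos _).le, le_trans (by gcongr; omega) hN⟩ (Real.exp_pos _).le
  rw [ae_all_iff]
  intro k
  have hnull : P.real {ω | ‖A k ω‖ ≤ 0} = 0 :=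
    le_antisymm ((hle k 0 h0).trans hg0) measureReal_nonneg
  rw [measureReal_eq_zero_iff] at hnull
  rw [ae_iff]
  simpa using hnull

theorem ae_subexponentialCoeffs (hA : ∀ k, Measurable (A k))
    (hupper : UniformUpperLogTail P A) (hlower : UniformLowerLogTail P A) :
    ∀ᵐ ω ∂P, SubexponentialCoeffs fun k => A k ω := by
  have hpos : ∀ m : ℕ, (0 : ℝ) < 1 / ((m : ℝ) + 1) := fun m => Nat.one_div_pos_of_nat
  -- Restricting to `ε = 1/(m + 1)` leaves countably many null sets.
  have h1 := ae_all_iff.2 fun m : ℕ => hupper.ae_eventually_le hA (hpos m)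
  have h2 := ae_all_iff.2 fun m : ℕ => hlower.ae_eventually_ge (hpos m)
  filter_upwards [h1, h2, hlower.ae_ne_zero] with ω hω1 hω2 hω0
  refine ⟨hω0, fun ε hε => ?_, fun ε hε => ?_⟩
  · obtain ⟨m, hm⟩ := exists_nat_one_div_lt hε
    filter_upwards [hω1 m] with k hk
    exact hk.trans (by gcongr)
  · obtain ⟨m, hm⟩ := exists_nat_one_div_lt hε
    filter_upwards [hω2 m] with k hk
    exact le_trans (by gcongr) hk

end Probability

/-- Almost surely every `P_n` has degree exactly `n`, and the zero counting measures of the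
`P_n` converge weakly to the normalized arclength measure on the unit circle. -/
theorem theorem2p1 {Ω : Type*} [MeasurableSpace Ω] (P : Measure Ω) [IsProbabilityMeasure P]
    (A : ℕ → Ω → ℂ) (hA : ∀ k, Measurable (A k))
    (hupper : UniformUpperLogTail P A) (hlower : UniformLowerLogTail P A) :
    ∀ᵐ ω ∂P,
      (∀ n, (kacPolynomial (fun k => A k ω) n).degree = (n : WithBot ℕ)) ∧
      Tendsto (fun n => zeroCountingFiniteMeasure (kacPolynomial (fun k => A k ω) n)) atTop
        (𝓝 unitCircleFiniteMeasure) := by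
  filter_upwards [ae_subexponentialCoeffs hA hupper hlower] with ω hω
  exact ⟨fun n => degree_kacPolynomial (hω.ne_zero n), hω.tendsto_zeroCountingFiniteMeasure⟩
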